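/- **Setting.** Let $\mathcal X,\mathcal U,\mathcal Y$ be complex Hilbert spaces; inner products and duality pairings are linear in the first argument, and $\mathcal H^*$ denotes the anti-dual of $\mathcal H$. Let $\left[\begin{smallmatrix}A\&B\\ C\&D\end{smallmatrix}\right]$ be a system node on $(\mathcal X,\mathcal U,\mathcal Y)$, that is: $A\&B:\mathcal X\times\mathcal U\supset\operatorname{dom}(A\&B)\to\mathcal X$ is a closed linear operator; $C\&D:\operatorname{dom}(A\&B)\to\mathcal Y$ is linear and bounded with respect to the graph norm of $A\&B$; for every $u\in\mathcal U$ there is $x\in\mathcal X$ with $(x,u)\in\operatorname{dom}(A\&B)$; and the operator $x\mapsto A\&B(x,0)$ with domain $\{x:(x,0)\in\operatorname{dom}(A\&B)\}$ generates a strongly continuous semigroup on $\mathcal X$. A *classical trajectory* on $[0,T]$ is a triple $(x,u,y)\in C^1([0,T];\mathcal X)\times C([0,T];\mathcal U)\times C([0,T];\mathcal Y)$ such that for all $t\in[0,T]$: $(x(t),u(t))\in\operatorname{dom}(A\&B)$, $\dot x(t)=A\&B(x(t),u(t))$ and $y(t)=C\&D(x(t),u(t))$ (one-sided derivatives at the end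 points). Let $\mathcal V=\{x\in\mathcal X:\exists u\in\mathcal U,\ (x,u)\in\operatorname{dom}(A\&B)\}$ with the norm $\|x\|_{\mathcal V}=\inf\{(\|x\|^2+\|u\|^2+\|A\&B(x,u)\|^2)^{1/2}: (x,u)\in\operatorname{dom}(A\&B)\}$. Let $Q=Q^*\in L(\mathcal Y)$, $S\in L(\mathcal U,\mathcal Y)$, $R=R^*\in L(\mathcal U)$, and $s(y,u)=\langle y,Qy+Su\rangle+\langle u,S^*y+Ru\rangle$. Let $\mathcal S:\mathcal X\supset\operatorname{dom}(\mathcal S)\to\mathbb R$ be a densely defined, semi-bounded, closed real quadratic form: $\operatorname{dom}(\mathcal S)$ is a dense subspace of $\mathcal X$; the map $h(x,z)=\frac14\big(\mathcal S(x+z)-\mathcal S(x-z)+i\,\mathcal S(x+iz)-i\,\mathcal S(x-iz)\big)$ is sesquilinear on $\operatorname{dom}(\mathcal S)$; and for some sign $\pm$ and some $\lambda\ge0$ the expression $(\pm\mathcal S(x)+\lambda\|x\|^2)^{1/2}$ is a norm on $\operatorname{dom}(\mathcal S)$ for which $\operatorname{dom}(\mathcal S)$ is complete and continuously embedded in $\mathcal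 X$. All norms of this form that give a continuous embedding in $\mathcal X$ are equivalent; $\operatorname{dom}(\mathcal S)$ carries such a norm. Let $\widetilde P\in L(\operatorname{dom}(\mathcal S),\operatorname{dom}(\mathcal S)^*)$ be the operator with $h(x,z)=\langle x,\widetilde Pz\rangle_{\operatorname{dom}(\mathcal S),\operatorname{dom}(\mathcal S)^*}$ for all $x,z\in\operatorname{dom}(\mathcal S)$. Assume that the system is dissipative with respect to the supply rate $s$ and the storage function $\mathcal S$: for all $T>0$ and every classical trajectory $(x,u,y)$ on $[0,T]$ one has $x(0),x(T)\in\operatorname{dom}(\mathcal S)$ and $$\mathcal S(x(T))-\mathcal S(x(0))+\int_0^Ts(y(t),u(t))\,dt\ge0 .$$ **Proposition.** Let $T>0$ and let $(x,u,y)$ be a classical trajectory on $[0,T]$. Then $x(t)\in\operatorname{dom}(\mathcal S)$ for all $t\in[0,T]$, and $t\mapsto\mathcal S(x(t))$ is continuous on $[0,T]$. If, moreover, $x\in C^2([0,T];\mathcal X)$ and $u\in C^1([0,T];\mathcal U)$, then $t\mapsto\mathcal S(x(t))$ is in $C^1([0,T])$. In this case $\mathcal V\subset\operatorname{dom}(\mathcal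 S)$, $\widetilde P$ restricts to a bounded operator from $\mathcal V$ to $\mathcal V^*$ (again denoted $\widetilde P$, with $\langle\widetilde Pv,w\rangle_{\mathcal V^*,\mathcal V}=\langle\widetilde Pv,w\rangle_{\operatorname{dom}(\mathcal S)^*,\operatorname{dom}(\mathcal S)}$ for $v,w\in\mathcal V$), one has $x(t)\in\mathcal V$ and $A\&B(x(t),u(t))\in\mathcal V$ for all $t\in[0,T]$, and $$\forall\,t\in[0,T]:\qquad \tfrac{d}{dt}\mathcal S(x(t))=2\operatorname{Re}\big\langle\widetilde Px(t),A\&B(x(t),u(t))\big\rangle_{\mathcal V^*,\mathcal V}.$$ -/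

import Mathlib

open Set Filter Topology
open scoped ComplexConjugate InnerProductSpace

noncomputable section

/-! ### Strongly continuous semigroups and their generators -/

/-- A strongly continuous semigroup of bounded operators on `X`; only the values at times `t ≥ 0`
are meaningful. -/
structure StronglyContinuousSemigroup (X : Type*) [NormedAddCommGroup X]
    [InnerProductSpace ℂ X] where
  op : ℝ → X →L[ℂ] X
  op_zero : op 0 = ContinuousLinearMap.id ℂ X
  op_add : ∀ s t : ℝ, 0 ≤ s → 0 ≤ t → op (s + t) = (op s).comp (op t)
  strong_cont : ∀ x : X, Tendsto (fun t : ℝ => op t x) (𝓝[>] 0) (𝓝 x)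

/-- `A` is the generator of the semigroup: `x ∈ dom A` with `A x = z` if and only if
`(𝔄(h) x - x) / h → z` as `h ↘ 0`. -/
def StronglyContinuousSemigroup.HasGenerator {X : Type*} [NormedAddCommGroup X]
    [InnerProductSpace ℂ X] (G : StronglyContinuousSemigroup X) (A : X →ₗ.[ℂ] X) : Prop :=
  ∀ x z : X, (x, z) ∈ A.graph ↔
    Tendsto (fun h : ℝ => ((h⁻¹ : ℝ) : ℂ) • (G.op h x - x)) (𝓝[>] 0) (𝓝 z)

/-! ### System nodes -/

section Node

variable {X U Y : Type*}
  [NormedAddCommGroup X] [InnerProductSpace ℂ X]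
  [NormedAddCommGroup U] [InnerProductSpace ℂ U]
  [NormedAddCommGroup Y] [InnerProductSpace ℂ Y]

/-- The graph norm `(‖x‖² + ‖u‖² + ‖A&B (x, u)‖²)^(1/2)` on the domain of an operator
`A&B : X × U ⊇ dom(A&B) → X`. -/
def graphNorm (AB : (X × U) →ₗ.[ℂ] X) (w : AB.domain) : ℝ :=
  Real.sqrt (‖w.1.1‖ ^ 2 + ‖w.1.2‖ ^ 2 + ‖AB w‖ ^ 2)

/-- The main operator `A x = A&B (x, 0)`, with domain `{x | (x, 0) ∈ dom(A&B)}`. -/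
def mainOperator (AB : (X × U) →ₗ.[ℂ] X) : X →ₗ.[ℂ] X where
  domain := AB.domain.comap (LinearMap.inl ℂ X U)
  toFun := AB.toFun.comp
    ((LinearMap.inl ℂ X U).restrict (p := AB.domain.comap (LinearMap.inl ℂ X U))
      (q := AB.domain) (fun _ hx => hx))

variable (X U Y) in
/-- A system node on `(X, U, Y)`. The operators `A&B` and `C&D` have the common domain
`AB.domain`. -/
structure SystemNode where
  AB : (X × U) →ₗ.[ℂ] X
  CD : AB.domain →ₗ[ℂ] Y
  closed : AB.IsClosed
  bounded : ∃ c : ℝ, ∀ w : AB.domain, ‖CD w‖ ≤ c * graphNorm AB w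
  exists_state : ∀ u : U, ∃ x : X, (x, u) ∈ AB.domain
  generates : ∃ G : StronglyContinuousSemigroup X, G.HasGenerator (mainOperator AB)

/-- Classical trajectories on `[0, T]` of `(ẋ, y) = (A&B (x, u), C&D (x, u))`; at the end points
of `[0, T]` derivatives are one-sided. -/
structure SystemNode.IsClassicalTrajectory (N : SystemNode X U Y) (T : ℝ)
    (x : ℝ → X) (u : ℝ → U) (y : ℝ → Y) : Prop where
  contDiffOn_state : ContDiffOn ℝ 1 x (Icc 0 T)
  continuousOn_input : ContinuousOn u (Icc 0 T)
  continuousOn_output : ContinuousOn y (Icc 0 T)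
  equation : ∀ t ∈ Icc 0 T, ∃ hw : (x t, u t) ∈ N.AB.domain,
    HasDerivWithinAt x (N.AB ⟨(x t, u t), hw⟩) (Icc 0 T) t ∧ y t = N.CD ⟨(x t, u t), hw⟩

/-! ### The space `V` of states that are admissible for some input value -/

/-- `V = {x | ∃ u, (x, u) ∈ dom(A&B)}` as a subspace of `X`. -/
def SystemNode.V (N : SystemNode X U Y) : Submodule ℂ X :=
  N.AB.domain.map (LinearMap.fst ℂ X U)

/-- The space `V`, to be equipped with its own norm (not the one inherited from `X`). -/
def SystemNode.VSpace (N : SystemNode X U Y) : Type _ := N.V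

instance (N : SystemNode X U Y) : AddCommGroup N.VSpace := inferInstanceAs (AddCommGroup N.V)

instance (N : SystemNode X U Y) : Module ℂ N.VSpace := inferInstanceAs (Module ℂ N.V)

/-- The underlying vector of `X`. -/
def SystemNode.VSpace.val {N : SystemNode X U Y} (v : N.VSpace) : X := Subtype.val (p := (· ∈ N.V)) v

/-- An element of `X` that lies in `V`, as a point of the normed space `V`. -/
def SystemNode.VSpace.mk {N : SystemNode X U Y} (x : X) (hx : x ∈ N.V) : N.VSpace :=
  (⟨x, hx⟩ : N.V)

theorem SystemNode.VSpace.val_mem {N : SystemNode X U Y} (v : N.VSpace) : v.val ∈ N.V :=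
  Subtype.property (p := (· ∈ N.V)) v

/-- `‖x‖_V = inf {‖(x, u)‖_{dom(A&B)} | u with (x, u) ∈ dom(A&B)}`. -/
instance (N : SystemNode X U Y) : Norm N.VSpace where
  norm v := sInf {r : ℝ | ∃ w : N.AB.domain, w.1.1 = v.val ∧ r = graphNorm N.AB w}

theorem graphNorm_eq (AB : (X × U) →ₗ.[ℂ] X) (w : AB.domain) :
    graphNorm AB w = ‖WithLp.toLp 2 (WithLp.toLp 2 (w.1.1, w.1.2), AB w)‖ := by
  rw [WithLp.prod_norm_eq_of_L2, WithLp.prod_norm_sq_eq_of_L2]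
  rfl

theorem graphNorm_nonneg (AB : (X × U) →ₗ.[ℂ] X) (w : AB.domain) : 0 ≤ graphNorm AB w :=
  Real.sqrt_nonneg _

theorem graphNorm_add_le (AB : (X × U) →ₗ.[ℂ] X) (w z : AB.domain) :
    graphNorm AB (w + z) ≤ graphNorm AB w + graphNorm AB z := by
  simp only [graphNorm_eq]
  refine le_trans (le_of_eq ?_) (norm_add_le _ _)
  congr 1
  rw [← WithLp.toLp_add, Prod.mk_add_mk, ← WithLp.toLp_add, Prod.mk_add_mk, LinearPMap.map_add]
  rfl

theorem graphNorm_smul (AB : (X × U) →ₗ.[ℂ] X) (c : ℂ) (w : AB.domain) :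
    graphNorm AB (c • w) = ‖c‖ * graphNorm AB w := by
  simp only [graphNorm_eq]
  rw [← norm_smul]
  congr 1
  rw [← WithLp.toLp_smul, Prod.smul_mk, ← WithLp.toLp_smul, Prod.smul_mk, LinearPMap.map_smul]
  rfl

theorem norm_fst_le_graphNorm (AB : (X × U) →ₗ.[ℂ] X) (w : AB.domain) :
    ‖w.1.1‖ ≤ graphNorm AB w := by
  apply Real.le_sqrt_of_sq_le
  nlinarith [sq_nonneg ‖w.1.2‖, sq_nonneg ‖AB w‖]

theorem SystemNode.VSpace.norm_le {N : SystemNode X U Y} (v : N.VSpace) (w : N.AB.domain)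
    (hw : w.1.1 = v.val) : ‖v‖ ≤ graphNorm N.AB w :=
  csInf_le ⟨0, by rintro _ ⟨z, _, rfl⟩; exact graphNorm_nonneg _ _⟩ ⟨w, hw, rfl⟩

theorem SystemNode.VSpace.le_norm {N : SystemNode X U Y} (v : N.VSpace) (r : ℝ)
    (h : ∀ w : N.AB.domain, w.1.1 = v.val → r ≤ graphNorm N.AB w) : r ≤ ‖v‖ := by
  apply le_csInf
  · obtain ⟨w, hw, hv⟩ := Submodule.mem_map.1 v.val_mem
    exact ⟨_, ⟨w, hw⟩, hv, rfl⟩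
  · rintro _ ⟨w, hw, rfl⟩
    exact h w hw

theorem SystemNode.VSpace.norm_smul_le {N : SystemNode X U Y} (c : ℂ) (v : N.VSpace) :
    ‖c • v‖ ≤ ‖c‖ * ‖v‖ := by
  by_cases hc : c = 0
  · subst hc
    refine le_trans (norm_le _ 0 ?_) (le_of_eq ?_)
    · simp only [zero_smul]; rfl
    · simpa using graphNorm_smul N.AB 0 0
  · have hc' : 0 < ‖c‖ := norm_pos_iff.2 hc
    rw [← div_le_iff₀' hc']
    refine le_norm v _ fun w hw => ?_
    rw [div_le_iff₀' hc', ← graphNorm_smul]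
    refine norm_le _ _ ?_
    change c • w.1.1 = c • v.val
    rw [hw]

theorem SystemNode.VSpace.core (N : SystemNode X U Y) : NormedSpace.Core ℂ N.VSpace where
  norm_nonneg v := v.le_norm 0 fun w _ => graphNorm_nonneg _ w
  norm_smul c v := by
    refine le_antisymm (norm_smul_le c v) ?_
    by_cases hc : c = 0
    · rw [hc, norm_zero, zero_mul]
      exact le_norm _ 0 fun w _ => graphNorm_nonneg _ w
    · have h := norm_smul_le c⁻¹ (c • v)
      rw [smul_smul, inv_mul_cancel₀ hc, one_smul, norm_inv] at h
      rwa [← le_inv_mul_iff₀ (norm_pos_iff.2 hc)]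
  norm_triangle v w := by
    rw [← sub_le_iff_le_add]
    refine le_norm v _ fun a ha => ?_
    rw [sub_le_iff_le_add, ← sub_le_iff_le_add']
    refine le_norm w _ fun b hb => ?_
    rw [sub_le_iff_le_add']
    refine le_trans (norm_le _ (a + b) ?_) (graphNorm_add_le _ _ _)
    change a.1.1 + b.1.1 = v.val + w.val
    rw [ha, hb]
  norm_eq_zero_iff v := by
    constructor
    · intro h
      have h' : ‖v.val‖ ≤ ‖v‖ := le_norm v _ fun w hw => hw ▸ norm_fst_le_graphNorm _ w
      rw [h] at h'
      exact Subtype.ext (norm_le_zero_iff.1 h')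
    · rintro rfl
      have h := norm_smul_le (N := N) 0 0
      rw [zero_smul, norm_zero, zero_mul] at h
      exact le_antisymm h (le_norm _ 0 fun w _ => graphNorm_nonneg _ w)

instance (N : SystemNode X U Y) : NormedAddCommGroup N.VSpace :=
  NormedAddCommGroup.ofCore (SystemNode.VSpace.core N)

instance (N : SystemNode X U Y) : NormedSpace ℂ N.VSpace :=
  NormedSpace.ofCore (SystemNode.VSpace.core N)

end Node

/-! ### Real quadratic forms -/

/-- The expression `(S(x+z) - S(x-z) + i S(x+iz) - i S(x-iz)) / 4`. -/
def polarForm {E : Type*} [AddCommGroup E] [Module ℂ E] (S : E → ℝ) (x z : E) : ℂ :=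
  (1 / 4 : ℂ) * ((S (x + z) : ℂ) - (S (x - z) : ℂ)
    + Complex.I * (S (x + Complex.I • z) : ℂ) - Complex.I * (S (x - Complex.I • z) : ℂ))

/-- A real quadratic form in `X` with domain `dom`: its polar form is sesquilinear (linear in the
first and conjugate linear in the second argument). -/
structure RealQuadraticForm (X : Type*) [NormedAddCommGroup X] [InnerProductSpace ℂ X] where
  dom : Submodule ℂ X
  toFun : dom → ℝ
  sesquilinear : ∃ h : dom →ₗ[ℂ] dom →ₗ⋆[ℂ] ℂ, ∀ x z, h x z = polarForm toFun x z

namespace RealQuadraticForm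

variable {X : Type*} [NormedAddCommGroup X] [InnerProductSpace ℂ X]

open Classical in
/-- The value of the form at a vector of its domain (and `0` at any other vector). -/
def value (S : RealQuadraticForm X) (x : X) : ℝ :=
  if hx : x ∈ S.dom then S.toFun ⟨x, hx⟩ else 0

/-- A choice of a sign `ε = ±1` and of `lam ≥ 0` such that `x ↦ (ε S(x) + lam ‖x‖²)^(1/2)` is a
norm on the domain of `S`, and the domain with this norm is continuously embedded in `X`. The
embedding holds automatically after enlarging `lam`, and any two such norms on the domain are
equivalent. The form is semi-bounded if and only if such a choice exists. -/
structure FormNorm (S : RealQuadraticForm X) where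
  ε : ℝ
  sign : ε = 1 ∨ ε = -1
  lam : ℝ
  lam_nonneg : 0 ≤ lam
  norm : Seminorm ℂ S.dom
  norm_sq : ∀ x : S.dom, norm x ^ 2 = ε * S.toFun x + lam * ‖(x : X)‖ ^ 2
  embed : ∃ c : ℝ, ∀ x : S.dom, ‖(x : X)‖ ≤ c * norm x

/-- The domain of `S`, to be equipped with the norm `n`. -/
def FormNorm.Space {S : RealQuadraticForm X} (_ : S.FormNorm) : Type _ := S.dom

section Space

variable {S : RealQuadraticForm X} (n : S.FormNorm)

instance : AddCommGroup n.Space := inferInstanceAs (AddCommGroup S.dom)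

instance : Module ℂ n.Space := inferInstanceAs (Module ℂ S.dom)

/-- An element of the domain of `S` as a point of the normed space `dom S`. -/
def FormNorm.pt (x : S.dom) : n.Space := x

instance : Norm n.Space where
  norm x := n.norm x

theorem FormNorm.core : NormedSpace.Core ℂ n.Space where
  norm_nonneg x := apply_nonneg n.norm x
  norm_smul c x := map_smul_eq_mul n.norm c x
  norm_triangle x z := map_add_le_add n.norm x z
  norm_eq_zero_iff x := by
    constructor
    · intro h
      obtain ⟨c, hc⟩ := n.embed
      have h0 : n.norm x = 0 := h
      have h1 := hc x
      rw [h0, mul_zero] at h1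
      exact Subtype.ext (norm_le_zero_iff.1 h1)
    · rintro rfl
      exact map_zero n.norm

instance : NormedAddCommGroup n.Space := NormedAddCommGroup.ofCore n.core

instance : NormedSpace ℂ n.Space := NormedSpace.ofCore n.core

end Space

/-- `S` is semi-bounded and closed: its domain is complete with respect to the norm
`(± S(x) + lam ‖x‖²)^(1/2)`. -/
def IsClosedSemibounded (S : RealQuadraticForm X) : Prop :=
  ∃ n : S.FormNorm, CompleteSpace n.Space

/-- `P : dom S → (dom S)*` (anti-dual) is the bounded operator representing the polar form `h`:
`h(x, z) = ⟨x, P z⟩`, where `⟨x, f⟩` is the conjugate of the value `f x = ⟨f, x⟩`. -/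
def FormNorm.Represents {S : RealQuadraticForm X} (n : S.FormNorm)
    (P : n.Space →L[ℂ] (n.Space →L⋆[ℂ] ℂ)) : Prop :=
  ∀ x z : S.dom, polarForm S.toFun x z = conj (P (n.pt z) (n.pt x))

theorem FormNorm.toFun_smul {S : RealQuadraticForm X} (n : S.FormNorm) (a : ℂ) (x : S.dom) :
    S.toFun (a • x) = ‖a‖ ^ 2 * S.toFun x := by
  have h1 := n.norm_sq (a • x)
  have h2 := n.norm_sq x
  rw [map_smul_eq_mul, mul_pow, h2, Submodule.coe_smul, norm_smul, mul_pow] at h1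
  rcases n.sign with h | h <;> rw [h] at h1 <;> linarith

theorem FormNorm.polarForm_conj {S : RealQuadraticForm X} (n : S.FormNorm) (x z : S.dom) :
    polarForm S.toFun x z = conj (polarForm S.toFun z x) := by
  have h1 : S.toFun (x - z) = S.toFun (z - x) := by
    have := n.toFun_smul (-1) (z - x)
    simpa using this
  have h2 : S.toFun (x + Complex.I • z) = S.toFun (z - Complex.I • x) := by
    have := n.toFun_smul Complex.I (z - Complex.I • x)
    rw [smul_sub, smul_smul, Complex.I_mul_I] at this
    simpa [add_comm] using this
  have h3 : S.toFun (x - Complex.I • z) = S.toFun (z + Complex.I • x) := by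
    have := n.toFun_smul (-Complex.I) (z + Complex.I • x)
    rw [smul_add, smul_smul, neg_mul, Complex.I_mul_I] at this
    simpa [add_comm, sub_eq_add_neg] using this
  simp only [polarForm, map_mul, map_add, map_sub, Complex.conj_ofReal, Complex.conj_I, map_div₀,
    map_one, map_ofNat, h1, h2, h3, add_comm z x]
  ring

theorem FormNorm.norm_polarForm_le {S : RealQuadraticForm X} (n : S.FormNorm) :
    ∃ C : ℝ, ∀ x z : S.dom, ‖polarForm S.toFun x z‖ ≤ C * n.norm x * n.norm z := by
  obtain ⟨c, hc⟩ := n.embed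
  obtain ⟨B, hB⟩ := S.sesquilinear
  have hlam := n.lam_nonneg
  have hS : ∀ w : S.dom, |S.toFun w| ≤ (1 + n.lam * c ^ 2) * n.norm w ^ 2 := by
    intro w
    have h1 := n.norm_sq w
    have h2 : ‖(w : X)‖ ^ 2 ≤ c ^ 2 * n.norm w ^ 2 := by
      rw [← mul_pow]
      exact pow_le_pow_left₀ (norm_nonneg _) (hc w) 2
    have h3 := mul_le_mul_of_nonneg_left h2 hlam
    have h4 : 0 ≤ n.lam * ‖(w : X)‖ ^ 2 := by positivity
    have h5 : 0 ≤ n.norm w ^ 2 := by positivity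
    rw [abs_le]
    rcases n.sign with h | h <;> rw [h] at h1 <;> constructor <;> nlinarith
  set K := 1 + n.lam * c ^ 2 with hK
  have hK0 : 0 ≤ K := by positivity
  have hb : ∀ x z : S.dom, n.norm x ≤ 1 → n.norm z ≤ 1 → ‖B x z‖ ≤ 4 * K := by
    intro x z hx hz
    have hI : n.norm (Complex.I • z) = n.norm z := by rw [map_smul_eq_mul]; simp
    have key : ∀ w : S.dom, n.norm w ≤ 2 → |S.toFun w| ≤ 4 * K := by
      intro w hw
      have h0 : 0 ≤ n.norm w := apply_nonneg _ _
      have : n.norm w ^ 2 ≤ 4 := by nlinarith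
      nlinarith [hS w]
    have k1 := key (x + z) ((map_add_le_add _ _ _).trans (by linarith))
    have k2 := key (x - z) ((map_sub_le_add _ _ _).trans (by linarith))
    have k3 := key (x + Complex.I • z) ((map_add_le_add _ _ _).trans (by linarith))
    have k4 := key (x - Complex.I • z) ((map_sub_le_add _ _ _).trans (by linarith))
    have e : ∀ r : ℝ, ‖(r : ℂ)‖ = |r| := fun r => by simp
    have e' : ∀ r : ℝ, ‖Complex.I * (r : ℂ)‖ = |r| := fun r => by simp
    rw [hB, polarForm, norm_mul]
    have h4 : ‖(1 / 4 : ℂ)‖ = 1 / 4 := by norm_num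
    rw [h4]
    have t1 := norm_sub_le ((S.toFun (x + z) : ℂ) - (S.toFun (x - z) : ℂ)
      + Complex.I * (S.toFun (x + Complex.I • z) : ℂ))
      (Complex.I * (S.toFun (x - Complex.I • z) : ℂ))
    have t2 := norm_add_le ((S.toFun (x + z) : ℂ) - (S.toFun (x - z) : ℂ))
      (Complex.I * (S.toFun (x + Complex.I • z) : ℂ))
    have t3 := norm_sub_le (S.toFun (x + z) : ℂ) (S.toFun (x - z) : ℂ)
    simp only [e, e'] at t1 t2 t3
    linarith
  have hz0 : ∀ x : S.dom, n.norm x = 0 → x = 0 := fun x hx => (n.core.norm_eq_zero_iff x).1 hx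
  refine ⟨4 * K, fun x z => ?_⟩
  rw [← hB]
  by_cases hx : n.norm x = 0
  · rw [hz0 x hx]; simp
  by_cases hz : n.norm z = 0
  · rw [hz0 z hz]; simp
  have hx' : 0 < n.norm x := lt_of_le_of_ne (apply_nonneg _ _) (Ne.symm hx)
  have hz' : 0 < n.norm z := lt_of_le_of_ne (apply_nonneg _ _) (Ne.symm hz)
  have hn : ∀ w : S.dom, 0 < n.norm w → n.norm (((n.norm w)⁻¹ : ℂ) • w) ≤ 1 := by
    intro w hw
    rw [map_smul_eq_mul, norm_inv, Complex.norm_real, Real.norm_of_nonneg hw.le,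
      inv_mul_cancel₀ hw.ne']
  have h := hb _ _ (hn x hx') (hn z hz')
  rw [LinearMap.map_smulₛₗ, LinearMap.map_smul B, LinearMap.smul_apply, norm_smul, norm_smul,
    RCLike.norm_conj, mul_left_comm, ← mul_assoc, norm_inv, norm_inv, Complex.norm_real, Complex.norm_real, Real.norm_of_nonneg hx'.le,
    Real.norm_of_nonneg hz'.le, ← mul_inv,
    inv_mul_le_iff₀ (mul_pos hx' hz')] at h
  linarith

/-- The representing operator exists and is unique. -/
theorem FormNorm.existsUnique_represents {S : RealQuadraticForm X} (n : S.FormNorm) :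
    ∃! P : n.Space →L[ℂ] (n.Space →L⋆[ℂ] ℂ), n.Represents P := by
  obtain ⟨B, hB⟩ := S.sesquilinear
  obtain ⟨C, hC⟩ := n.norm_polarForm_le
  let B' : n.Space →ₗ[ℂ] n.Space →ₗ⋆[ℂ] ℂ := B
  refine ⟨B'.mkContinuous₂ C fun x z => ?_, fun x z => ?_, fun P hP => ?_⟩
  · have h := hC x z
    rw [← hB x z] at h
    exact h
  · have h := n.polarForm_conj x z
    rw [← hB z x] at h
    exact h
  · ext z x
    have h := (n.polarForm_conj x z).symm.trans (hP x z)
    rw [← hB z x] at h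
    exact ((starRingEnd ℂ).injective h).symm

end RealQuadraticForm

/-! ### Dissipativity -/

section Dissipativity

variable {X U Y : Type*}
  [NormedAddCommGroup X] [InnerProductSpace ℂ X]
  [NormedAddCommGroup U] [InnerProductSpace ℂ U] [CompleteSpace U]
  [NormedAddCommGroup Y] [InnerProductSpace ℂ Y] [CompleteSpace Y]

/-- The supply rate `s(y, u) = ⟨(y, u), (Q y + S u, S* y + R u)⟩`, which is real for self-adjoint
`Q` and `R`. -/
def supplyRate (Q : Y →L[ℂ] Y) (S : U →L[ℂ] Y) (R : U →L[ℂ] U) (y : Y) (u : U) : ℝ :=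
  (⟪y, Q y + S u⟫_ℂ + ⟪u, ContinuousLinearMap.adjoint S y + R u⟫_ℂ).re

/-- The system is dissipative with respect to the supply rate `s` and the storage function `St`. -/
def SystemNode.IsDissipative (N : SystemNode X U Y) (s : Y → U → ℝ)
    (St : RealQuadraticForm X) : Prop :=
  ∀ (T : ℝ), 0 < T → ∀ (x : ℝ → X) (u : ℝ → U) (y : ℝ → Y), N.IsClassicalTrajectory T x u y →
    x 0 ∈ St.dom ∧ x T ∈ St.dom ∧
      0 ≤ St.value (x T) - St.value (x 0) + ∫ t in (0 : ℝ)..T, s (y t) (u t)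

end Dissipativity

end

/-! The state component of `A&B` maps its graph into `V`. If `V ⊆ dom 𝒮`, which dissipativity forces
because every point of `dom (A&B)` starts a classical trajectory with constant input, the closed
graph theorem makes this map bounded from the graph into the Hilbert space `dom 𝒮`. Along a
classical trajectory `t ↦ ((x, u), ẋ)` is a curve in the graph, so its image in `dom 𝒮` is as smooth
as the curve, and `𝒮` is a bounded quadratic form there: the derivative of `𝒮(x)` is a product
rule. Orthogonal projection onto the graph spares us curves in a subtype: bounded operators on the
graph extend to the ambient product. -/

section BoundedOperators

variable {𝕜 E F G : Type*}

theorem continuous_of_injective_of_continuous_comp [NontriviallyNormedField 𝕜]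
    [NormedAddCommGroup E] [NormedSpace 𝕜 E] [CompleteSpace E]
    [NormedAddCommGroup F] [NormedSpace 𝕜 F] [CompleteSpace F] [TopologicalSpace G] [T2Space G]
    {f : E →ₗ[𝕜] F} {ι : F → G} (hι : Continuous ι) (hinj : Function.Injective ι)
    (hf : Continuous fun v => ι (f v)) : Continuous f :=
  f.continuous_of_seq_closed_graph fun _ v z hv hz =>
    hinj (tendsto_nhds_unique ((hι.tendsto z).comp hz) ((hf.tendsto v).comp hv))

theorem closedComplemented_of_isClosed_of_equiv [RCLike 𝕜] [AddCommGroup E] [Module 𝕜 E]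
    [TopologicalSpace E] [NormedAddCommGroup F] [InnerProductSpace 𝕜 F] [CompleteSpace F]
    (e : E ≃L[𝕜] F) {K : Submodule 𝕜 E} (hK : IsClosed (K : Set E)) : K.ClosedComplemented := by
  have hclosed : IsClosed (K.map (e : E →ₗ[𝕜] F) : Set F) := e.toHomeomorph.isClosed_image.2 hK
  have : CompleteSpace (K.map (e : E →ₗ[𝕜] F)) := hclosed.completeSpace_coe
  let p : F →L[𝕜] K.map (e : E →ₗ[𝕜] F) := (K.map (e : E →ₗ[𝕜] F)).orthogonalProjectionOnto
  refine ⟨((e.submoduleMap K).symm : _ →L[𝕜] K) ∘L p ∘L (e : E →L[𝕜] F), fun w => ?_⟩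
  have hp : p (e w) = e.submoduleMap K w :=
    Submodule.orthogonalProjectionOnto_mem_subspace_eq_self (e.submoduleMap K w)
  simp [hp]

theorem derivWithin_mem_of_isClosed [NontriviallyNormedField 𝕜] [NormedAddCommGroup E]
    [NormedSpace 𝕜 E] {K : Submodule 𝕜 E} (hK : IsClosed (K : Set E)) {f : 𝕜 → E} {s : Set 𝕜}
    (hf : ∀ t ∈ s, f t ∈ K) (t : 𝕜) : derivWithin f s t ∈ K := by
  have hspan : (Submodule.span 𝕜 (f '' s) : Set E) ⊆ K :=
    Submodule.span_le.2 (image_subset_iff.2 hf)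
  have hs : s ⊆ closure (s ∩ s) := by rw [inter_self]; exact subset_closure
  exact closure_minimal hspan hK (range_derivWithin_subset_closure_span_image f hs ⟨t, rfl⟩)

theorem isBoundedBilinearMap_re [NormedAddCommGroup E] [NormedSpace ℂ E] [NormedAddCommGroup F]
    [NormedSpace ℂ F] (B : E →L[ℂ] F →L⋆[ℂ] ℂ) :
    IsBoundedBilinearMap ℝ fun q : E × F => (B q.1 q.2).re where
  add_left v₁ v₂ w := by simp
  smul_left c v w := by rw [← Complex.coe_smul c v]; simp
  add_right v w₁ w₂ := by simp
  smul_right c v w := by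
    change (B v ((c : ℂ) • w)).re = c • (B v w).re
    rw [(B v).map_smulₛₗ, Complex.conj_ofReal, Complex.coe_smul, Complex.smul_re]
  bound := by
    refine ⟨‖B‖ + 1, by positivity, fun v w => (Complex.abs_re_le_norm _).trans ?_⟩
    calc ‖B v w‖ ≤ ‖B‖ * ‖v‖ * ‖w‖ := B.le_opNorm₂ v w
      _ ≤ (‖B‖ + 1) * ‖v‖ * ‖w‖ := by gcongr; exact le_add_of_nonneg_right zero_le_one

end BoundedOperators

namespace StronglyContinuousSemigroup

variable {X : Type*} [NormedAddCommGroup X] [InnerProductSpace ℂ X]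
  (G : StronglyContinuousSemigroup X)

theorem op_zero_apply (b : X) : G.op 0 b = b := by
  rw [G.op_zero, ContinuousLinearMap.id_apply]

theorem op_add_apply {s t : ℝ} (hs : 0 ≤ s) (ht : 0 ≤ t) (b : X) :
    G.op (s + t) b = G.op s (G.op t b) := by
  rw [G.op_add s t hs ht, ContinuousLinearMap.comp_apply]

theorem tendsto_op_zero (b : X) : Tendsto (fun t => G.op t b) (𝓝[≥] 0) (𝓝 b) := by
  have h : ContinuousWithinAt (fun t => G.op t b) (Ioi 0) 0 := by
    simpa only [ContinuousWithinAt, G.op_zero_apply] using G.strong_cont b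
  simpa only [ContinuousWithinAt, Ioi_insert, G.op_zero_apply] using
    continuousWithinAt_insert_self.2 h

theorem norm_op_sub_op_le {s t : ℝ} (hs : 0 ≤ s) (ht : 0 ≤ t) (b : X) :
    ‖G.op s b - G.op t b‖ ≤ ‖G.op (min s t)‖ * ‖G.op |s - t| b - b‖ := by
  wlog hst : t ≤ s generalizing s t
  · rw [norm_sub_rev, min_comm, abs_sub_comm]
    exact this ht hs (le_of_not_ge hst)
  have h := G.op_add_apply ht (sub_nonneg.2 hst) b
  rw [add_sub_cancel] at h
  rw [min_eq_right hst, abs_of_nonneg (sub_nonneg.2 hst), h, ← map_sub]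
  exact (G.op t).le_opNorm _

/-- The orbit `t ↦ 𝔄(t) b`, extended evenly to negative times, where the values of the semigroup
are meaningless, so that it becomes continuous on the whole line. -/
def orbit (b : X) (t : ℝ) : X := G.op |t| b

theorem orbit_of_nonneg (b : X) {t : ℝ} (ht : 0 ≤ t) : G.orbit b t = G.op t b := by
  rw [orbit, abs_of_nonneg ht]

theorem orbit_zero (b : X) : G.orbit b 0 = b := by
  rw [G.orbit_of_nonneg b le_rfl, G.op_zero_apply]

variable [CompleteSpace X]

theorem exists_norm_op_le_near_zero : ∃ δ > 0, ∃ M : ℝ, ∀ t ∈ Icc 0 δ, ‖G.op t‖ ≤ M := by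
  by_contra! hunbounded
  choose τ hτ hlt using fun k : ℕ => hunbounded (1 / ((k : ℝ) + 1)) Nat.one_div_pos_of_nat k
  have hlim : Tendsto τ atTop (𝓝[≥] 0) :=
    tendsto_nhdsWithin_iff.2 ⟨squeeze_zero (fun k => (hτ k).1) (fun k => (hτ k).2)
      tendsto_one_div_add_atTop_nhds_zero_nat, Eventually.of_forall fun k => (hτ k).1⟩
  obtain ⟨C, hC⟩ := banach_steinhaus (g := fun k => G.op (τ k)) fun b => by
    obtain ⟨C, hC⟩ := ((G.tendsto_op_zero b).comp hlim).norm.bddAbove_range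
    exact ⟨C, fun k => hC ⟨k, rfl⟩⟩
  obtain ⟨k, hk⟩ := exists_nat_gt C
  exact (hC k).not_gt (hk.trans (hlt k))

theorem exists_norm_op_le (r : ℝ) : ∃ M : ℝ, ∀ t ∈ Icc 0 r, ‖G.op t‖ ≤ M := by
  obtain ⟨δ, hδ, M, hM⟩ := G.exists_norm_op_le_near_zero
  have hstep : ∀ k : ℕ, ∃ M' : ℝ, ∀ t ∈ Icc 0 (k * δ), ‖G.op t‖ ≤ M' := by
    intro k
    induction k with
    | zero => exact ⟨‖G.op 0‖, fun t ht => by simp_all⟩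
    | succ k ih =>
      obtain ⟨M', hM'⟩ := ih
      refine ⟨M * M', fun t ht => ?_⟩
      set a := min t δ
      have ha0 : 0 ≤ a := le_min ht.1 hδ.le
      have hrest : t - a ∈ Icc 0 (k * δ) := by
        refine ⟨sub_nonneg.2 (min_le_left t δ), ?_⟩
        have hk : 0 ≤ k * δ := by positivity
        have := ht.2
        push_cast at this
        rcases min_cases t δ with h | h <;> linarith
      have hsplit := G.op_add a (t - a) ha0 hrest.1
      rw [add_sub_cancel] at hsplit
      rw [hsplit]
      exact (ContinuousLinearMap.opNorm_comp_le _ _).trans <|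
        mul_le_mul (hM a ⟨ha0, min_le_right t δ⟩) (hM' _ hrest) (norm_nonneg _)
          ((norm_nonneg _).trans (hM 0 ⟨le_rfl, hδ.le⟩))
  obtain ⟨k, hk⟩ := exists_nat_ge (r / δ)
  obtain ⟨M', hM'⟩ := hstep k
  exact ⟨M', fun t ht => hM' t ⟨ht.1, ht.2.trans ((div_le_iff₀ hδ).1 hk)⟩⟩

theorem continuous_orbit (b : X) : Continuous (G.orbit b) := by
  refine continuous_iff_continuousAt.2 fun t => ?_
  obtain ⟨M, hM⟩ := G.exists_norm_op_le |t|
  have hgap : Tendsto (fun s : ℝ => |(|s| - |t|)|) (𝓝 t) (𝓝[≥] 0) := by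
    refine tendsto_nhdsWithin_iff.2 ⟨?_, Eventually.of_forall fun _ => mem_Ici.2 (abs_nonneg _)⟩
    exact (by fun_prop : Continuous fun s : ℝ => |(|s| - |t|)|).tendsto' t 0 (by simp)
  have hbound : Tendsto (fun s => M * ‖G.op |(|s| - |t|)| b - b‖) (𝓝 t) (𝓝 0) := by
    simpa using (((G.tendsto_op_zero b).comp hgap).sub_const b).norm.const_mul M
  refine tendsto_iff_norm_sub_tendsto_zero.2 (squeeze_zero (fun _ => norm_nonneg _) ?_ hbound)
  intro s
  refine (G.norm_op_sub_op_le (abs_nonneg s) (abs_nonneg t) b).trans ?_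
  gcongr
  exact hM _ ⟨le_min (abs_nonneg s) (abs_nonneg t), min_le_right _ _⟩

theorem hasDerivAt_integral_orbit (b : X) (t : ℝ) :
    HasDerivAt (fun r => ∫ s in (0 : ℝ)..r, G.orbit b s) (G.orbit b t) t :=
  intervalIntegral.integral_hasDerivAt_right ((G.continuous_orbit b).intervalIntegrable _ _)
    ((G.continuous_orbit b).stronglyMeasurableAtFilter _ _) (G.continuous_orbit b).continuousAt

theorem op_integral_orbit (b : X) {h t : ℝ} (hh : 0 ≤ h) (ht : 0 ≤ t) :
    G.op h (∫ s in (0 : ℝ)..t, G.orbit b s) =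
      (∫ s in (0 : ℝ)..(t + h), G.orbit b s) - ∫ s in (0 : ℝ)..(0 + h), G.orbit b s := by
  have hfi := fun r s => (G.continuous_orbit b).intervalIntegrable (μ := MeasureTheory.volume) r s
  have hshift : ∀ s ∈ uIcc 0 t, G.op h (G.orbit b s) = G.orbit b (s + h) := by
    intro s hs
    rw [uIcc_of_le ht] at hs
    rw [G.orbit_of_nonneg b hs.1, G.orbit_of_nonneg b (add_nonneg hs.1 hh), add_comm,
      G.op_add_apply hh hs.1]
  calc G.op h (∫ s in (0 : ℝ)..t, G.orbit b s)
      = ∫ s in (0 : ℝ)..t, G.op h (G.orbit b s) :=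
        (ContinuousLinearMap.intervalIntegral_comp_comm _ (hfi _ _)).symm
    _ = ∫ s in (0 : ℝ)..t, G.orbit b (s + h) := intervalIntegral.integral_congr hshift
    _ = ∫ s in (0 + h)..(t + h), G.orbit b s := intervalIntegral.integral_comp_add_right _ _
    _ = _ := (intervalIntegral.integral_interval_sub_left (hfi _ _) (hfi _ _)).symm

theorem HasGenerator.integral_orbit_mem_graph {G : StronglyContinuousSemigroup X} {A : X →ₗ.[ℂ] X}
    (hA : G.HasGenerator A) (b : X) {t : ℝ} (ht : 0 ≤ t) :
    (∫ s in (0 : ℝ)..t, G.orbit b s, G.orbit b t - b) ∈ A.graph := by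
  have hslope_t := (G.hasDerivAt_integral_orbit b t).tendsto_slope_zero_right
  have hslope_0 := (G.hasDerivAt_integral_orbit b 0).tendsto_slope_zero_right
  rw [G.orbit_zero] at hslope_0
  refine (hA _ _).2 ((hslope_t.sub hslope_0).congr' ?_)
  filter_upwards [self_mem_nhdsWithin] with h hh
  rw [G.op_integral_orbit b (mem_Ioi.1 hh).le ht, Complex.coe_smul, ← smul_sub,
    intervalIntegral.integral_same, sub_zero, sub_right_comm]

end StronglyContinuousSemigroup

namespace RealQuadraticForm

variable {X : Type*} [NormedAddCommGroup X] [InnerProductSpace ℂ X] {S : RealQuadraticForm X}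

theorem value_of_mem {x : X} (hx : x ∈ S.dom) : S.value x = S.toFun ⟨x, hx⟩ :=
  dif_pos hx

namespace FormNorm

theorem polarForm_self (n : S.FormNorm) (x : S.dom) : polarForm S.toFun x x = S.toFun x := by
  have hadd : S.toFun (x + x) = 4 * S.toFun x := by
    rw [← two_smul ℂ x, n.toFun_smul]
    norm_num
  have hsub : S.toFun (x - x) = 0 := by
    rw [sub_self, ← zero_smul ℂ x, n.toFun_smul]
    simp
  have hrot : S.toFun (x + Complex.I • x) = S.toFun (x - Complex.I • x) := by
    have h := n.toFun_smul Complex.I (x - Complex.I • x)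
    rw [smul_sub, smul_smul, Complex.I_mul_I, neg_one_smul, sub_neg_eq_add, add_comm] at h
    simpa using h
  rw [polarForm, hadd, hsub, hrot]
  push_cast
  ring

theorem exists_abs_toFun_le (n : S.FormNorm) :
    ∃ C : ℝ, ∀ x : S.dom, |S.toFun x| ≤ C * n.norm x ^ 2 := by
  obtain ⟨C, hC⟩ := n.norm_polarForm_le
  refine ⟨C, fun x => ?_⟩
  simpa [n.polarForm_self, pow_two, mul_assoc] using hC x x

theorem exists_norm_le (n m : S.FormNorm) : ∃ C : ℝ, ∀ x : S.dom, n.norm x ≤ C * m.norm x := by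
  obtain ⟨C, hC⟩ := m.exists_abs_toFun_le
  obtain ⟨c, hc⟩ := m.embed
  refine ⟨√(|C| + n.lam * c ^ 2), fun x => ?_⟩
  have hlam := n.lam_nonneg
  have : 0 ≤ m.norm x := apply_nonneg _ _
  have hsign : n.ε * S.toFun x ≤ |S.toFun x| := by
    rcases n.sign with h | h <;> simp [h, le_abs_self, neg_le_abs]
  have hsq : n.norm x ^ 2 ≤ (|C| + n.lam * c ^ 2) * m.norm x ^ 2 := by
    calc n.norm x ^ 2 = n.ε * S.toFun x + n.lam * ‖(x : X)‖ ^ 2 := n.norm_sq x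
      _ ≤ |C| * m.norm x ^ 2 + n.lam * (c * m.norm x) ^ 2 :=
        add_le_add (hsign.trans ((hC x).trans (by gcongr; exact le_abs_self C)))
          (by gcongr; exact hc x)
      _ = _ := by ring
  refine le_of_sq_le_sq ?_ (by positivity)
  rwa [mul_pow, Real.sq_sqrt (by positivity)]

theorem completeSpace (hS : S.IsClosedSemibounded) (n : S.FormNorm) : CompleteSpace n.Space := by
  obtain ⟨m, hm⟩ := hS
  obtain ⟨C, hC⟩ := n.exists_norm_le m
  obtain ⟨C', hC'⟩ := m.exists_norm_le n
  let e : m.Space ≃L[ℂ] n.Space :=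
    LinearEquiv.toContinuousLinearEquivOfBounds (LinearEquiv.refl ℂ S.dom : m.Space ≃ₗ[ℂ] n.Space)
      C C' hC hC'
  exact (completeSpace_congr (e := e.toEquiv) e.isUniformEmbedding).1 hm

/-- The continuous embedding of the domain of the form, normed by `n`, into the state space. -/
noncomputable def inclusion (n : S.FormNorm) : n.Space →L[ℂ] X :=
  LinearMap.mkContinuousOfExistsBound (show n.Space →ₗ[ℂ] X from S.dom.subtype) n.embed

theorem inclusion_injective (n : S.FormNorm) : Function.Injective n.inclusion :=
  Subtype.val_injective

theorem inclusion_mem (n : S.FormNorm) (ξ : n.Space) : n.inclusion ξ ∈ S.dom :=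
  Subtype.property (p := (· ∈ S.dom)) ξ

theorem exists_lift (hS : S.IsClosedSemibounded) (n : S.FormNorm) {E : Type*}
    [NormedAddCommGroup E] [NormedSpace ℂ E] [CompleteSpace E] (f : E →L[ℂ] X)
    (hf : ∀ v, f v ∈ S.dom) : ∃ J : E →L[ℂ] n.Space, ∀ v, n.inclusion (J v) = f v := by
  have := n.completeSpace hS
  let J : E →ₗ[ℂ] n.Space := (f : E →ₗ[ℂ] X).codRestrict S.dom hf
  exact ⟨⟨J, continuous_of_injective_of_continuous_comp (f := J) n.inclusion.continuous
    n.inclusion_injective f.continuous⟩, fun _ => rfl⟩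

namespace Represents

variable {n : S.FormNorm} {P : n.Space →L[ℂ] (n.Space →L⋆[ℂ] ℂ)}

theorem value_inclusion (hP : n.Represents P) (ξ : n.Space) :
    S.value (n.inclusion ξ) = (P ξ ξ).re := by
  have h := congrArg Complex.re ((n.polarForm_self ξ).symm.trans (hP ξ ξ))
  rw [Complex.conj_re, Complex.ofReal_re] at h
  exact (value_of_mem (n.inclusion_mem ξ)).trans h

theorem re_symm (hP : n.Represents P) (ξ η : n.Space) : (P ξ η).re = (P η ξ).re := by
  have h : conj (P η ξ) = conj (conj (P ξ η)) :=
    (hP ξ η).symm.trans ((n.polarForm_conj ξ η).trans (congrArg conj (hP η ξ)))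
  simpa using (congrArg Complex.re h).symm

theorem hasDerivWithinAt_value (hP : n.Represents P) {ξ : ℝ → n.Space} {ξ' : n.Space} {s : Set ℝ}
    {t : ℝ} (hξ : HasDerivWithinAt ξ ξ' s t) :
    HasDerivWithinAt (fun τ => S.value (n.inclusion (ξ τ))) (2 * (P (ξ t) ξ').re) s t := by
  simp only [hP.value_inclusion]
  have h := ((isBoundedBilinearMap_re P).hasFDerivAt (ξ t, ξ t)).comp_hasDerivWithinAt t
    (hξ.prodMk hξ)
  refine h.congr_deriv ?_
  change (P (ξ t) ξ').re + (P ξ' (ξ t)).re = _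
  rw [hP.re_symm ξ', two_mul]

end Represents

theorem contDiff_value_inclusion (n : S.FormNorm) {k : WithTop ℕ∞} :
    ContDiff ℝ k fun ξ : n.Space => S.value (n.inclusion ξ) := by
  obtain ⟨P, hP, -⟩ := n.existsUnique_represents
  simp only [hP.value_inclusion]
  exact (isBoundedBilinearMap_re P).contDiff.comp (contDiff_id.prodMk contDiff_id)

end FormNorm

end RealQuadraticForm

section GraphNorm

variable {X U : Type*} [NormedAddCommGroup X] [InnerProductSpace ℂ X]
  [NormedAddCommGroup U] [InnerProductSpace ℂ U] {AB : (X × U) →ₗ.[ℂ] X}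

theorem norm_le_graphNorm (w : AB.domain) : ‖((w : X × U), AB w)‖ ≤ graphNorm AB w := by
  refine max_le (max_le (norm_fst_le_graphNorm AB w) ?_) ?_ <;> apply Real.le_sqrt_of_sq_le
  · linarith [sq_nonneg ‖w.1.1‖, sq_nonneg ‖AB w‖]
  · linarith [sq_nonneg ‖w.1.1‖, sq_nonneg ‖w.1.2‖]

theorem graphNorm_le_two_mul_norm (w : AB.domain) :
    graphNorm AB w ≤ 2 * ‖((w : X × U), AB w)‖ := by
  set r := ‖((w : X × U), AB w)‖
  have hx : ‖w.1.1‖ ^ 2 ≤ r ^ 2 := by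
    gcongr; exact (norm_fst_le (w : X × U)).trans (norm_fst_le ((w : X × U), AB w))
  have hu : ‖w.1.2‖ ^ 2 ≤ r ^ 2 := by
    gcongr; exact (norm_snd_le (w : X × U)).trans (norm_fst_le ((w : X × U), AB w))
  have hAB : ‖AB w‖ ^ 2 ≤ r ^ 2 := by gcongr; exact norm_snd_le ((w : X × U), AB w)
  refine Real.sqrt_le_iff.2 ⟨by positivity, ?_⟩
  linarith [sq_nonneg r, mul_pow 2 r 2]

theorem mem_graph_mainOperator_iff {a z : X} :
    (a, z) ∈ (mainOperator AB).graph ↔ ((a, (0 : U)), z) ∈ AB.graph := by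
  simp only [LinearPMap.mem_graph_iff]
  constructor
  · rintro ⟨v, rfl, hz⟩
    exact ⟨⟨((v : X), 0), v.2⟩, rfl, hz⟩
  · rintro ⟨⟨_, hmem⟩, rfl, hz⟩
    exact ⟨⟨a, hmem⟩, rfl, hz⟩

end GraphNorm

section GraphCurve

variable {X U : Type*} [NormedAddCommGroup X] [NormedSpace ℝ X] [NormedAddCommGroup U]
  [NormedSpace ℝ U] {T t : ℝ} {x : ℝ → X} {u : ℝ → U}

/-- The curve `t ↦ ((x(t), u(t)), ẋ(t))`, with one-sided derivatives at the end points of `[0, T]`.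
For a classical trajectory on `[0, T]` it lies in the graph of `A&B`. -/
noncomputable def graphCurve (T : ℝ) (x : ℝ → X) (u : ℝ → U) (t : ℝ) : (X × U) × X :=
  ((x t, u t), derivWithin x (Icc 0 T) t)

theorem contDiffOn_graphCurve (hT : 0 < T) {k m : WithTop ℕ∞} (hkm : k + 1 ≤ m)
    (hx : ContDiffOn ℝ m x (Icc 0 T)) (hu : ContDiffOn ℝ k u (Icc 0 T)) :
    ContDiffOn ℝ k (graphCurve T x u) (Icc 0 T) :=
  ((hx.of_le (le_self_add.trans hkm)).prodMk hu).prodMk (hx.derivWithin (uniqueDiffOn_Icc hT) hkm)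

theorem fst_fst_derivWithin_graphCurve (hT : 0 < T) (ht : t ∈ Icc 0 T)
    (h : DifferentiableWithinAt ℝ (graphCurve T x u) (Icc 0 T) t) :
    (derivWithin (graphCurve T x u) (Icc 0 T) t).1.1 = derivWithin x (Icc 0 T) t := by
  have hx : HasDerivWithinAt x (derivWithin (graphCurve T x u) (Icc 0 T) t).1.1 (Icc 0 T) t :=
    h.hasDerivWithinAt.fst.fst
  exact (hx.derivWithin (uniqueDiffOn_Icc hT t ht)).symm

end GraphCurve

namespace SystemNode

variable {X U Y : Type*}
  [NormedAddCommGroup X] [InnerProductSpace ℂ X]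
  [NormedAddCommGroup U] [InnerProductSpace ℂ U]
  [NormedAddCommGroup Y] [InnerProductSpace ℂ Y]

namespace IsClassicalTrajectory

variable {N : SystemNode X U Y} {T t : ℝ} {x : ℝ → X} {u : ℝ → U} {y : ℝ → Y}

theorem mem_V (h : N.IsClassicalTrajectory T x u y) (ht : t ∈ Icc 0 T) : x t ∈ N.V :=
  ⟨(x t, u t), (h.equation t ht).1, rfl⟩

theorem graphCurve_mem (h : N.IsClassicalTrajectory T x u y) (hT : 0 < T) (ht : t ∈ Icc 0 T) :
    graphCurve T x u t ∈ N.AB.graph := by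
  obtain ⟨hw, hx, -⟩ := h.equation t ht
  rw [graphCurve, hx.derivWithin (uniqueDiffOn_Icc hT t ht)]
  exact N.AB.mem_graph ⟨_, hw⟩

theorem derivWithin_graphCurve_mem (h : N.IsClassicalTrajectory T x u y) (hT : 0 < T) (t : ℝ) :
    derivWithin (graphCurve T x u) (Icc 0 T) t ∈ N.AB.graph :=
  derivWithin_mem_of_isClosed (K := N.AB.graph.restrictScalars ℝ) N.closed
    (fun _ hτ => h.graphCurve_mem hT hτ) t

theorem derivWithin_mem_V (h : N.IsClassicalTrajectory T x u y) (hT : 0 < T) (ht : t ∈ Icc 0 T)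
    (hdiff : DifferentiableWithinAt ℝ (graphCurve T x u) (Icc 0 T) t) :
    derivWithin x (Icc 0 T) t ∈ N.V :=
  ⟨_, LinearPMap.mem_domain_of_mem_graph (h.derivWithin_graphCurve_mem hT t),
    fst_fst_derivWithin_graphCurve hT ht hdiff⟩

end IsClassicalTrajectory

variable [CompleteSpace X] [CompleteSpace U]

section GraphOperators

variable (N : SystemNode X U Y)

theorem closedComplemented_graph : N.AB.graph.ClosedComplemented :=
  closedComplemented_of_isClosed_of_equiv
    (((WithLp.prodContinuousLinearEquiv 2 ℂ (WithLp 2 (X × U)) X).trans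
      ((WithLp.prodContinuousLinearEquiv 2 ℂ X U).prodCongr (.refl ℂ X))).symm) N.closed

theorem exists_clm_extend_graph {Z : Type*} [NormedAddCommGroup Z] [NormedSpace ℂ Z]
    (L : N.AB.graph →L[ℂ] Z) :
    ∃ L' : (X × U) × X →L[ℂ] Z, ∀ p (hp : p ∈ N.AB.graph), L' p = L ⟨p, hp⟩ := by
  obtain ⟨p, hp⟩ := N.closedComplemented_graph
  exact ⟨L ∘L p, fun w hw => congrArg L (hp ⟨w, hw⟩)⟩

theorem exists_clm_output :
    ∃ C : (X × U) × X →L[ℂ] Y, ∀ w : N.AB.domain, C (w, N.AB w) = N.CD w := by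
  obtain ⟨c, hc⟩ := N.bounded
  let q : N.AB.graph →ₗ[ℂ] N.AB.domain :=
    (LinearMap.fst ℂ (X × U) X).restrict fun _ hp => LinearPMap.mem_domain_of_mem_graph hp
  have hq : ∀ p : N.AB.graph, N.AB (q p) = p.1.2 := fun p =>
    ((LinearPMap.image_iff (LinearPMap.mem_domain_of_mem_graph p.2)).2 p.2).symm
  obtain ⟨C, hC⟩ := N.exists_clm_extend_graph <| (N.CD ∘ₗ q).mkContinuous (|c| * 2) fun p => by
    calc ‖N.CD (q p)‖ ≤ |c| * graphNorm N.AB (q p) :=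
          (hc _).trans (mul_le_mul_of_nonneg_right (le_abs_self c) (graphNorm_nonneg _ _))
      _ ≤ |c| * (2 * ‖((q p : X × U), N.AB (q p))‖) := by
          gcongr; exact graphNorm_le_two_mul_norm _
      _ = |c| * 2 * ‖p‖ := by rw [hq, mul_assoc]; rfl
  exact ⟨C, fun w => hC _ (N.AB.mem_graph w)⟩

variable {N} {St : RealQuadraticForm X}

theorem exists_clm_state (hV : N.V ≤ St.dom) (hS : St.IsClosedSemibounded) (n : St.FormNorm) :
    ∃ J : (X × U) × X →L[ℂ] n.Space, ∀ p ∈ N.AB.graph, n.inclusion (J p) = p.1.1 := by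
  have hclosed : IsClosed (N.AB.graph : Set ((X × U) × X)) := N.closed
  have : CompleteSpace N.AB.graph := hclosed.completeSpace_coe
  let f : N.AB.graph →L[ℂ] X := .fst ℂ X U ∘L .fst ℂ (X × U) X ∘L N.AB.graph.subtypeL
  obtain ⟨J, hJ⟩ := n.exists_lift hS f fun p =>
    hV ⟨p.1.1, LinearPMap.mem_domain_of_mem_graph p.2, rfl⟩
  obtain ⟨J', hJ'⟩ := N.exists_clm_extend_graph J
  exact ⟨J', fun p hp => (congrArg n.inclusion (hJ' p hp)).trans (hJ ⟨p, hp⟩)⟩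

theorem exists_clm_VSpace (hV : N.V ≤ St.dom) (hS : St.IsClosedSemibounded) (n : St.FormNorm) :
    ∃ j : N.VSpace →L[ℂ] n.Space, ∀ v, j v = n.pt ⟨v.val, hV v.val_mem⟩ := by
  obtain ⟨J, hJ⟩ := exists_clm_state hV hS n
  let j : N.VSpace →ₗ[ℂ] n.Space := Submodule.inclusion hV
  refine ⟨j.mkContinuous (‖J‖ + 1) fun v => ?_, fun _ => rfl⟩
  rw [← div_le_iff₀' (by positivity)]
  refine v.le_norm _ fun w hw => ?_
  have hjv : j v = J (w, N.AB w) :=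
    n.inclusion_injective (hw.symm.trans (hJ _ (N.AB.mem_graph w)).symm)
  rw [div_le_iff₀' (by positivity), hjv]
  calc ‖J (w, N.AB w)‖ ≤ ‖J‖ * ‖((w : X × U), N.AB w)‖ := J.le_opNorm _
    _ ≤ (‖J‖ + 1) * graphNorm N.AB w := by
      gcongr
      · exact le_add_of_nonneg_right zero_le_one
      · exact norm_le_graphNorm w

end GraphOperators

section Trajectories

variable {N : SystemNode X U Y} {St : RealQuadraticForm X} {T t : ℝ} {x : ℝ → X} {u : ℝ → U}
  {y : ℝ → Y}

theorem exists_isClassicalTrajectory_of_mem_graph (hT : 0 < T) (hx : ContDiffOn ℝ 1 x (Icc 0 T))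
    (hu : ContinuousOn u (Icc 0 T))
    (hgraph : ∀ t ∈ Icc 0 T, graphCurve T x u t ∈ N.AB.graph) :
    ∃ y : ℝ → Y, N.IsClassicalTrajectory T x u y := by
  obtain ⟨C, hC⟩ := N.exists_clm_output
  have hcurve := (contDiffOn_graphCurve hT (zero_add 1).le hx (contDiffOn_zero.2 hu)).continuousOn
  refine ⟨fun t => C (graphCurve T x u t), hx, hu, C.continuous.comp_continuousOn hcurve,
    fun t ht => ?_⟩
  have hw : (x t, u t) ∈ N.AB.domain := LinearPMap.mem_domain_of_mem_graph (hgraph t ht)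
  have hAB : derivWithin x (Icc 0 T) t = N.AB ⟨(x t, u t), hw⟩ :=
    (LinearPMap.image_iff hw).2 (hgraph t ht)
  refine ⟨hw, hAB ▸ (hx.differentiableOn one_ne_zero t ht).hasDerivWithinAt, ?_⟩
  rw [← hC, ← hAB, graphCurve]

theorem exists_isClassicalTrajectory_const_input (N : SystemNode X U Y) (hT : 0 < T)
    (w : N.AB.domain) :
    ∃ (x : ℝ → X) (y : ℝ → Y), N.IsClassicalTrajectory T x (fun _ => w.1.2) y ∧ x 0 = w.1.1 := by
  obtain ⟨G, hG⟩ := N.generates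
  let x : ℝ → X := fun t => w.1.1 + ∫ s in (0 : ℝ)..t, G.orbit (N.AB w) s
  have hderiv : ∀ t, HasDerivAt x (G.orbit (N.AB w) t) t := fun t =>
    (G.hasDerivAt_integral_orbit (N.AB w) t).const_add _
  have hx : ContDiff ℝ 1 x := contDiff_one_iff_deriv.2
    ⟨fun t => (hderiv t).differentiableAt, by
      rw [funext fun t => (hderiv t).deriv]; exact G.continuous_orbit _⟩
  obtain ⟨y, hy⟩ := exists_isClassicalTrajectory_of_mem_graph (N := N) hT hx.contDiffOn
    (continuousOn_const (c := w.1.2)) fun t ht => by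
      have hsum := N.AB.graph.add_mem (N.AB.mem_graph w)
        (mem_graph_mainOperator_iff.1 (hG.integral_orbit_mem_graph (N.AB w) ht.1))
      rw [graphCurve, (hderiv t).hasDerivWithinAt.derivWithin (uniqueDiffOn_Icc hT t ht)]
      convert hsum using 1
      simp [x, Prod.ext_iff]
  exact ⟨x, y, hy, by simp [x]⟩

theorem IsDissipative.V_le_dom {s : Y → U → ℝ} (h : N.IsDissipative s St) : N.V ≤ St.dom := by
  rintro _ ⟨w, hw, rfl⟩
  obtain ⟨x, y, htraj, hx0⟩ := N.exists_isClassicalTrajectory_const_input one_pos ⟨w, hw⟩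
  have hmem := (h 1 one_pos x _ y htraj).1
  rwa [hx0] at hmem

namespace IsClassicalTrajectory

theorem contDiffOn_value (h : N.IsClassicalTrajectory T x u y) (hT : 0 < T) (hV : N.V ≤ St.dom)
    (hS : St.IsClosedSemibounded) {k m : WithTop ℕ∞} (hkm : k + 1 ≤ m)
    (hx : ContDiffOn ℝ m x (Icc 0 T)) (hu : ContDiffOn ℝ k u (Icc 0 T)) :
    ContDiffOn ℝ k (fun t => St.value (x t)) (Icc 0 T) := by
  have ⟨n, _⟩ := hS
  obtain ⟨J, hJ⟩ := exists_clm_state hV hS n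
  have hlift := (J.restrictScalars ℝ).contDiff.comp_contDiffOn
    (contDiffOn_graphCurve hT hkm hx hu)
  exact (n.contDiff_value_inclusion.comp_contDiffOn hlift).congr fun t ht =>
    congrArg St.value (hJ _ (h.graphCurve_mem hT ht)).symm

theorem hasDerivWithinAt_value (h : N.IsClassicalTrajectory T x u y) (hT : 0 < T)
    (hV : N.V ≤ St.dom) (hS : St.IsClosedSemibounded)
    (hdiff : DifferentiableWithinAt ℝ (graphCurve T x u) (Icc 0 T) t) {n : St.FormNorm}
    {P : n.Space →L[ℂ] (n.Space →L⋆[ℂ] ℂ)} (hP : n.Represents P) (ht : t ∈ Icc 0 T)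
    {ξ ξ' : n.Space} (hξ : n.inclusion ξ = x t)
    (hξ' : n.inclusion ξ' = derivWithin x (Icc 0 T) t) :
    HasDerivWithinAt (fun τ => St.value (x τ)) (2 * (P ξ ξ').re) (Icc 0 T) t := by
  obtain ⟨J, hJ⟩ := exists_clm_state hV hS n
  have hJx : ∀ τ ∈ Icc 0 T, n.inclusion (J (graphCurve T x u τ)) = x τ := fun τ hτ =>
    hJ _ (h.graphCurve_mem hT hτ)
  have hJx' : n.inclusion (J (derivWithin (graphCurve T x u) (Icc 0 T) t)) =
      derivWithin x (Icc 0 T) t :=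
    (hJ _ (h.derivWithin_graphCurve_mem hT t)).trans (fst_fst_derivWithin_graphCurve hT ht hdiff)
  have hlift : HasDerivWithinAt (fun τ => J (graphCurve T x u τ))
      (J (derivWithin (graphCurve T x u) (Icc 0 T) t)) (Icc 0 T) t :=
    (J.restrictScalars ℝ).hasFDerivAt.comp_hasDerivWithinAt t hdiff.hasDerivWithinAt
  have hvalue := (hP.hasDerivWithinAt_value hlift).congr
    (fun τ hτ => congrArg St.value (hJx τ hτ).symm) (congrArg St.value (hJx t ht).symm)
  rwa [n.inclusion_injective ((hJx t ht).trans hξ.symm),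
    n.inclusion_injective (hJx'.trans hξ'.symm)] at hvalue

end IsClassicalTrajectory

end Trajectories

end SystemNode

theorem proposition3p3_general {X U Y : Type*}
    [NormedAddCommGroup X] [InnerProductSpace ℂ X] [CompleteSpace X]
    [NormedAddCommGroup U] [InnerProductSpace ℂ U] [CompleteSpace U]
    [NormedAddCommGroup Y] [InnerProductSpace ℂ Y]
    (N : SystemNode X U Y) (St : RealQuadraticForm X)
    (hV : N.V ≤ St.dom) (hclosed : St.IsClosedSemibounded)
    (T : ℝ) (hT : 0 < T) (x : ℝ → X) (u : ℝ → U) (y : ℝ → Y)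
    (htraj : N.IsClassicalTrajectory T x u y) :
    (∀ t ∈ Icc 0 T, x t ∈ St.dom) ∧
    ContinuousOn (fun t => St.value (x t)) (Icc 0 T) ∧
    (ContDiffOn ℝ 2 x (Icc 0 T) → ContDiffOn ℝ 1 u (Icc 0 T) →
      ContDiffOn ℝ 1 (fun t => St.value (x t)) (Icc 0 T) ∧
      ∀ (n : St.FormNorm) (P : n.Space →L[ℂ] (n.Space →L⋆[ℂ] ℂ)), n.Represents P →
        ∃ PV : N.VSpace →L[ℂ] (N.VSpace →L⋆[ℂ] ℂ),
          (∃ hV : N.V ≤ St.dom, ∀ v w : N.VSpace,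
            PV v w = P (n.pt ⟨v.val, hV v.val_mem⟩) (n.pt ⟨w.val, hV w.val_mem⟩)) ∧
          ∀ t ∈ Icc 0 T, ∃ (hx : x t ∈ N.V) (hw : (x t, u t) ∈ N.AB.domain)
            (hAB : N.AB ⟨(x t, u t), hw⟩ ∈ N.V),
            HasDerivWithinAt (fun τ => St.value (x τ))
              (2 * (PV (SystemNode.VSpace.mk (x t) hx)
                (SystemNode.VSpace.mk (N.AB ⟨(x t, u t), hw⟩) hAB)).re)
              (Icc 0 T) t) := by
  refine ⟨fun t ht => hV (htraj.mem_V ht), ?_, fun hx hu => ⟨?_, fun n P hP => ?_⟩⟩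
  · exact (htraj.contDiffOn_value hT hV hclosed (zero_add 1).le htraj.contDiffOn_state
      (contDiffOn_zero.2 htraj.continuousOn_input)).continuousOn
  · exact htraj.contDiffOn_value hT hV hclosed one_add_one_eq_two.le hx hu
  obtain ⟨j, hj⟩ := SystemNode.exists_clm_VSpace hV hclosed n
  refine ⟨P.bilinearComp j j, ⟨hV, fun v w => ?_⟩, fun t ht => ?_⟩
  · rw [ContinuousLinearMap.bilinearComp_apply, hj, hj]
  have hdiff := (contDiffOn_graphCurve hT one_add_one_eq_two.le hx hu).differentiableOn
    one_ne_zero t ht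
  obtain ⟨hw, hderiv, -⟩ := htraj.equation t ht
  have hx' := hderiv.derivWithin (uniqueDiffOn_Icc hT t ht)
  have hAB : N.AB ⟨(x t, u t), hw⟩ ∈ N.V :=
    hx' ▸ htraj.derivWithin_mem_V hT ht hdiff
  refine ⟨htraj.mem_V ht, hw, hAB, ?_⟩
  rw [ContinuousLinearMap.bilinearComp_apply, hj, hj]
  exact htraj.hasDerivWithinAt_value hT hV hclosed hdiff hP ht rfl hx'.symm

theorem proposition3p3 {X U Y : Type*}
    [NormedAddCommGroup X] [InnerProductSpace ℂ X] [CompleteSpace X]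
    [NormedAddCommGroup U] [InnerProductSpace ℂ U] [CompleteSpace U]
    [NormedAddCommGroup Y] [InnerProductSpace ℂ Y] [CompleteSpace Y]
    (N : SystemNode X U Y)
    (Q : Y →L[ℂ] Y) (S : U →L[ℂ] Y) (R : U →L[ℂ] U)
    (hQ : IsSelfAdjoint Q) (hR : IsSelfAdjoint R)
    (St : RealQuadraticForm X)
    (hdense : Dense (St.dom : Set X)) (hclosed : St.IsClosedSemibounded)
    (hdiss : N.IsDissipative (supplyRate Q S R) St)
    (T : ℝ) (hT : 0 < T) (x : ℝ → X) (u : ℝ → U) (y : ℝ → Y)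
    (htraj : N.IsClassicalTrajectory T x u y) :
    (∀ t ∈ Icc 0 T, x t ∈ St.dom) ∧
    ContinuousOn (fun t => St.value (x t)) (Icc 0 T) ∧
    (ContDiffOn ℝ 2 x (Icc 0 T) → ContDiffOn ℝ 1 u (Icc 0 T) →
      ContDiffOn ℝ 1 (fun t => St.value (x t)) (Icc 0 T) ∧
      ∀ (n : St.FormNorm) (P : n.Space →L[ℂ] (n.Space →L⋆[ℂ] ℂ)), n.Represents P →
        ∃ PV : N.VSpace →L[ℂ] (N.VSpace →L⋆[ℂ] ℂ),
          (∃ hV : N.V ≤ St.dom, ∀ v w : N.VSpace,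
            PV v w = P (n.pt ⟨v.val, hV v.val_mem⟩) (n.pt ⟨w.val, hV w.val_mem⟩)) ∧
          ∀ t ∈ Icc 0 T, ∃ (hx : x t ∈ N.V) (hw : (x t, u t) ∈ N.AB.domain)
            (hAB : N.AB ⟨(x t, u t), hw⟩ ∈ N.V),
            HasDerivWithinAt (fun τ => St.value (x τ))
              (2 * (PV (SystemNode.VSpace.mk (x t) hx)
                (SystemNode.VSpace.mk (N.AB ⟨(x t, u t), hw⟩) hAB)).re)
              (Icc 0 T) t) :=
  proposition3p3_general N St hdiss.V_le_dom hclosed T hT x u y htraj
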